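/- Let $g,n$ be positive integers, $N=2gn$ and $\lambda\in[0,1]$. For $0\le w\le N$ let $|D^N_w\rangle=\binom{N}{w}^{-1/2}\sum_{x\in\{0,1\}^N,\ x_1+\dots+x_N=w}|x_1\rangle\otimes\dots\otimes|x_N\rangle$ be the Dicke states, and let $$|\varphi_2\rangle = 2^{-n/2}\sum_{j=0}^n\sqrt{\tbinom nj}\,|D^N_{gj}\rangle$$ be the gnu probe state on $N$ qubits. Let $Z_j$ be the Pauli $Z$ operator acting on qubit $j$, let $H=\sum_{j=1}^N Z_j$, and let $$\mathcal D_\lambda(\rho)=\lambda\rho+\frac{1-\lambda}{N}\sum_{j=1}^N Z_j\rho Z_j .$$ For a density matrix $\rho$ with eigenvalues $p_j$ and an orthonormal eigenbasis $|e_j\rangle$, the quantum Fisher information (QFI) of $\rho$ with respect to the generator $H$ is $2\sum_{j,k:\,p_j+p_k\ne0}\frac{(p_j-p_k)^2}{p_j+p_k}|\langle e_j|H|e_k\rangle|^2$. Let $v_k=\langle\varphi_2|Z_1\cdots Z_k|\varphi_2\rangle$. Then the QFI of $\mathcal D_\lambda(|\varphi_2\rangle\langle\varphi_2|)$ with respect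 to $H$ is at least $$2g^2n\lambda^2+2\lambda(1-\lambda)\frac{g^2(n-1)}{2}+(1-\lambda)^2\frac{g_2}{N^2},$$ where $g_2=2(z_{0,2,2}-z_{1,1,2})$, $$z_{0,2,2}=N(N-1)v_2\big((N-2)(N-3)v_4+(5N-8)v_2+2\big)+N^2+N^2(N-1)v_2,$$ $$z_{1,1,2}=N(N-1)(N-2)^2v_3^2+N(N-1)+2N(N-1)(N-2)v_3+\frac{N^3}{4}.$$ Moreover $$v_2=\frac{g(n+1)-2}{4gn-2},$$ and, if $gn\ge2$, $$v_3=\frac{g^2n(n+3)-6gn+2}{4(gn-1)(2gn-1)},\qquad v_4=\frac{(n^3+6n^2+3n-2)g^3-12n(n+1)g^2+4(5n+2)g-12}{4(gn-1)(2gn-3)(2gn-1)} .$$ (If $gn=1$, then $N=2$, and $v_3$ and $v_4$ occur in $g_2$ only with coefficient $0$.) -/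

import Mathlib

namespace Gnu

/-- Computational basis labels of an `N`-qubit register: bit strings `x_1 … x_N`. -/
abbrev Bits (N : ℕ) : Type := Fin N → Fin 2

/-- Operators on `N` qubits, as matrices in the computational basis. -/
abbrev Op (N : ℕ) : Type := Matrix (Bits N) (Bits N) ℂ

/-- State vectors of `N` qubits, by their amplitudes in the computational basis. -/
abbrev Ket (N : ℕ) : Type := Bits N → ℂ

/-- The number of ones in a bit string. -/
def weight {N : ℕ} (x : Bits N) : ℕ := ∑ i, (x i : ℕ)

/-- The Pauli operator `Z_j`: `Z_j |x⟩ = (-1)^{x_j} |x⟩`. -/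
def pauliZ {N : ℕ} (j : Fin N) : Op N :=
  Matrix.diagonal fun x => (-1 : ℂ) ^ (x j : ℕ)

/-- The generator `H = Z_1 + ⋯ + Z_N`. -/
def hamiltonian (N : ℕ) : Op N := ∑ j, pauliZ j

/-- The Dicke state `|D^N_w⟩`. -/
noncomputable def dicke (N w : ℕ) : Ket N := fun x =>
  if weight x = w then ((1 / √(N.choose w : ℝ) : ℝ) : ℂ) else 0

/-- The gnu probe state `2^{-n/2} ∑_{j=0}^n √(n choose j) |D^N_{gj}⟩` on `N` qubits
(where `N = g n u`; the state `φ_2` is the case `N = 2 g n`). -/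
noncomputable def probe (N g n : ℕ) : Ket N :=
  ∑ j ∈ Finset.range (n + 1),
    ((√((2 : ℝ)⁻¹ ^ n) * √(n.choose j : ℝ) : ℝ) : ℂ) • dicke N (g * j)

/-- The rank one operator `|ψ⟩⟨ψ|`. -/
def proj {N : ℕ} (ψ : Ket N) : Op N := Matrix.vecMulVec ψ (star ψ)

/-- The expectation value `⟨ψ|A|ψ⟩`. -/
def expect {N : ℕ} (ψ : Ket N) (A : Op N) : ℂ := star ψ ⬝ᵥ (A.mulVec ψ)

/-- The operator `Z_1 Z_2 ⋯ Z_k` on `N` qubits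
(used for `k ≤ N`; for `k > N` the product runs over all the qubits). -/
def zString (N k : ℕ) : Op N := (((List.finRange N).take k).map pauliZ).prod

/-- The correlator `v_k = ⟨φ|Z_1 ⋯ Z_k|φ⟩` of the probe state `φ`. The operator is Hermitian,
so the expectation value is real. -/
noncomputable def corr (N g n k : ℕ) : ℝ := (expect (probe N g n) (zString N k)).re

/-- The channel `D_lam`: no error with probability `lam`, and `Z_j` with probability
`(1 - lam) / N` for each `j`. -/
noncomputable def dephase {N : ℕ} (lam : ℝ) (ρ : Op N) : Op N :=
  (lam : ℂ) • ρ + (((1 - lam) / N : ℝ) : ℂ) • ∑ j, pauliZ j * ρ * pauliZ j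

/-- The quantum Fisher information of the state `ρ` with respect to the generator `H`, that is,
of the family `exp(-iχH) ρ exp(iχH)`:
`2 ∑_{j,k : p_j + p_k ≠ 0} (p_j - p_k)² / (p_j + p_k) |⟨e_j|H|e_k⟩|²`
for an orthonormal eigenbasis `e_j` of `ρ` with eigenvalues `p_j`. The terms with
`p_j + p_k = 0` are `0` here since division by `0` gives `0`. -/
noncomputable def qfi {ι : Type*} [Fintype ι] [DecidableEq ι]
    (ρ H : Matrix ι ι ℂ) (hρ : ρ.IsHermitian) : ℝ :=
  2 * ∑ j, ∑ k,
    (hρ.eigenvalues j - hρ.eigenvalues k) ^ 2 / (hρ.eigenvalues j + hρ.eigenvalues k) *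
      ‖(star (hρ.eigenvectorUnitary : Matrix ι ι ℂ) * H *
          (hρ.eigenvectorUnitary : Matrix ι ι ℂ)) j k‖ ^ 2

theorem pauliZ_isHermitian {N : ℕ} (j : Fin N) : (pauliZ j).IsHermitian := by
  apply Matrix.isHermitian_diagonal_of_self_adjoint
  ext x
  simp

theorem proj_isHermitian {N : ℕ} (ψ : Ket N) : (proj ψ).IsHermitian := by
  ext x y
  simp [proj, Matrix.vecMulVec_apply, mul_comm]

theorem dephase_isHermitian {N : ℕ} (lam : ℝ) {ρ : Op N} (hρ : ρ.IsHermitian) :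
    (dephase lam ρ).IsHermitian := by
  have h := fun j : Fin N => (pauliZ_isHermitian j).eq
  unfold Matrix.IsHermitian dephase
  simp [Matrix.conjTranspose_add, Matrix.conjTranspose_smul, Matrix.conjTranspose_sum,
    Matrix.conjTranspose_mul, h, hρ.eq, Matrix.mul_assoc]

/-- The state `D_lam(|φ⟩⟨φ|)` is Hermitian. -/
theorem noisy_isHermitian (N g n : ℕ) (lam : ℝ) :
    (dephase lam (proj (probe N g n))).IsHermitian :=
  dephase_isHermitian lam (proj_isHermitian _)

/-- The quantity `z_{0,2,2}` as a function of `N`, `v_2`, `v_4`. -/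
def z022 (N v2 v4 : ℝ) : ℝ :=
  N * (N - 1) * v2 * ((N - 2) * (N - 3) * v4 + (5 * N - 8) * v2 + 2)
    + N ^ 2 + N ^ 2 * (N - 1) * v2

/-- The quantity `z_{1,1,2}` as a function of `N`, `v_3`. -/
noncomputable def z112 (N v3 : ℝ) : ℝ :=
  N * (N - 1) * (N - 2) ^ 2 * v3 ^ 2 + N * (N - 1)
    + 2 * N * (N - 1) * (N - 2) * v3 + N ^ 3 / 4

/-- The quantity `g_2 = 2 (z_{0,2,2} - z_{1,1,2})`. -/
noncomputable def g2 (N v2 v3 v4 : ℝ) : ℝ := 2 * (z022 N v2 v4 - z112 N v3)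

end Gnu

/-! The eigenvalues `p_j` of a state satisfy `p_j + p_k ≤ 2`, so each QFI term dominates `(p_j -
p_k)² |⟨e_j|H|e_k⟩|²`. The QFI is therefore at least the squared Hilbert–Schmidt norm of `[ρ, H]`
(`sum_norm_sq_commutator_le_qfi`), and the stated bound is exactly this norm.

That norm does not depend on the basis. In the computational basis `H` is diagonal and dephasing
multiplies the entries of `|φ⟩⟨φ|` by a real factor, so only the distribution `p(x) = |φ(x)|²`
matters, through moments `⟨Z_S H^m⟩` with `|S|, m ≤ 2` (`sum_commutator_eq_mean`). Since `p` is
permutation invariant, such a moment is a number `a k m` with `k = |S|`, and `Z_i² = 1` gives `a k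
(m+1) = k a (k-1) m + (N-k) a (k+1) m` (`moment_firstQubits_succ`).

The row `k = 0` consists of moments of `H = g (2n - 2j)` with `j` a fair binomial variable, known
from `sum_choose_mul_shift_pow`. Solving the recursion from that row yields the correlators `v_k = a
k 0` and the three terms of the bound. -/

/-! ### The commutator lower bound for the QFI. -/

open Matrix in
-- The sum is `tr (C Cᴴ)`. This moves the commutator norm between the eigenbasis, where it meets the
-- QFI, and the computational basis, where it is computed.
theorem Matrix.sum_norm_sq_unitary_conj {ι : Type*} [Fintype ι] [DecidableEq ι]
    (U : unitaryGroup ι ℂ) (C : Matrix ι ι ℂ) :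
    ∑ j, ∑ k, ‖(star (U : Matrix ι ι ℂ) * C * (U : Matrix ι ι ℂ)) j k‖ ^ 2
      = ∑ j, ∑ k, ‖C j k‖ ^ 2 := by
  have key : ∀ B : Matrix ι ι ℂ, ((∑ j, ∑ k, ‖B j k‖ ^ 2 : ℝ) : ℂ) = (B * Bᴴ).trace := by
    intro B
    simp [Matrix.trace, Matrix.mul_apply, Complex.mul_conj, Complex.normSq_eq_norm_sq]
  have hU : (U : Matrix ι ι ℂ) * star (U : Matrix ι ι ℂ) = 1 := by simp
  have h : ((star (U : Matrix ι ι ℂ) * C * (U : Matrix ι ι ℂ)) *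
      (star (U : Matrix ι ι ℂ) * C * (U : Matrix ι ι ℂ))ᴴ).trace = (C * Cᴴ).trace := by
    rw [← Matrix.star_eq_conjTranspose, star_mul, star_mul, star_star]
    calc (star (U : Matrix ι ι ℂ) * C * U * (star (U : Matrix ι ι ℂ) * (star C * U))).trace
        = (star (U : Matrix ι ι ℂ) * (C * (U * star (U : Matrix ι ι ℂ)) * (star C * U))).trace := by
          simp only [Matrix.mul_assoc]
      _ = (C * Cᴴ).trace := by
          rw [Matrix.trace_mul_comm, hU, Matrix.mul_one, Matrix.mul_assoc, Matrix.mul_assoc, hU,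
            Matrix.mul_one, Matrix.star_eq_conjTranspose]
  exact_mod_cast (key _).trans (h.trans (key _).symm)

namespace Gnu

open Matrix ComplexOrder in
/-- For a state (positive semidefinite of trace one), the QFI is bounded below by the squared
Hilbert–Schmidt norm of the commutator of the state with the generator. -/
theorem sum_norm_sq_commutator_le_qfi {ι : Type*} [Fintype ι] [DecidableEq ι]
    {ρ : Matrix ι ι ℂ} (H : Matrix ι ι ℂ) (hρ : ρ.PosSemidef) (htr : ρ.trace = 1) :
    ∑ j, ∑ k, ‖(ρ * H - H * ρ) j k‖ ^ 2 ≤ qfi ρ H hρ.isHermitian := by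
  set hh := hρ.isHermitian
  set U := hh.eigenvectorUnitary
  set p := hh.eigenvalues
  have h0 : ∀ i, 0 ≤ p i := hρ.eigenvalues_nonneg
  have hsum : ∑ i, p i = 1 := by
    have := hh.trace_eq_sum_eigenvalues
    rw [htr] at this
    exact Complex.ofReal_injective (by rw [Complex.ofReal_sum, Complex.ofReal_one]; exact this.symm)
  have h1 : ∀ i, p i ≤ 1 := fun i =>
    hsum ▸ Finset.single_le_sum (fun j _ => h0 j) (Finset.mem_univ i)
  have hU : star (U : Matrix ι ι ℂ) * (U : Matrix ι ι ℂ) = 1 := by simp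
  set D : Matrix ι ι ℂ := diagonal (RCLike.ofReal ∘ p)
  have hspec : ρ = U * D * star (U : Matrix ι ι ℂ) := by
    have := hh.spectral_theorem
    rwa [Unitary.conjStarAlgAut_apply] at this
  set K := star (U : Matrix ι ι ℂ) * H * U
  have hcomm : star (U : Matrix ι ι ℂ) * (ρ * H - H * ρ) * U = D * K - K * D := by
    have e1 : star (U : Matrix ι ι ℂ) * (ρ * H) * U
        = (star (U : Matrix ι ι ℂ) * U) * D * K := by
      rw [hspec]; simp only [K, Matrix.mul_assoc]
    have e2 : star (U : Matrix ι ι ℂ) * (H * ρ) * U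
        = K * D * (star (U : Matrix ι ι ℂ) * U) := by
      rw [hspec]; simp only [K, Matrix.mul_assoc]
    rw [mul_sub, sub_mul, e1, e2, hU, one_mul, mul_one]
  rw [← Matrix.sum_norm_sq_unitary_conj U, hcomm, qfi, Finset.mul_sum]
  refine Finset.sum_le_sum fun j _ => ?_
  rw [Finset.mul_sum]
  refine Finset.sum_le_sum fun k _ => ?_
  have hent : (D * K - K * D) j k = ((p j - p k : ℝ) : ℂ) * K j k := by
    simp [D, Matrix.sub_apply]
    ring
  rw [hent, norm_mul, mul_pow, Complex.norm_real, Real.norm_eq_abs, sq_abs, ← mul_assoc]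
  refine mul_le_mul_of_nonneg_right ?_ (sq_nonneg _)
  change (p j - p k) ^ 2 ≤ 2 * ((p j - p k) ^ 2 / (p j + p k))
  -- If `p j + p k = 0`, both eigenvalues vanish and so do both sides; otherwise `p j + p k ≤ 2`
  -- suffices.
  rcases (add_nonneg (h0 j) (h0 k)).eq_or_lt with hz | hz
  · have hj : p j = 0 := by linarith [h0 j, h0 k]
    have hk : p k = 0 := by linarith [h0 j, h0 k]
    simp [hj, hk]
  · rw [← mul_div_assoc, le_div_iff₀ hz]
    nlinarith [sq_nonneg (p j - p k), h1 j, h1 k]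

/-! ### The dephased state in the computational basis. -/

/-- The eigenvalue `±1` of `Z_j` on the basis state `x`. -/
def sgn {N : ℕ} (x : Bits N) (j : Fin N) : ℝ := (-1) ^ (x j : ℕ)

theorem sgn_mul_self {N : ℕ} (x : Bits N) (j : Fin N) : sgn x j * sgn x j = 1 := by
  simp [sgn, ← mul_pow]

/-- The eigenvalue of `H` on the basis state `x`. -/
def energy {N : ℕ} (x : Bits N) : ℝ := ∑ j, sgn x j

theorem energy_eq {N : ℕ} (x : Bits N) : energy x = N - 2 * weight x := by
  have h : ∀ j, sgn x j = 1 - 2 * ((x j : ℕ) : ℝ) := by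
    intro j
    unfold sgn
    have h : ∀ b : Fin 2, (-1 : ℝ) ^ (b : ℕ) = 1 - 2 * ((b : ℕ) : ℝ) := by
      intro b
      fin_cases b <;> norm_num
    exact h _
  simp [energy, weight, h, Finset.mul_sum]

theorem pauliZ_eq {N : ℕ} (j : Fin N) :
    pauliZ j = Matrix.diagonal fun x : Bits N => ((sgn x j : ℝ) : ℂ) := by
  simp [pauliZ, sgn]

theorem hamiltonian_eq (N : ℕ) :
    hamiltonian N = Matrix.diagonal fun x : Bits N => ((energy x : ℝ) : ℂ) := by
  ext x y
  simp [hamiltonian, pauliZ_eq, Matrix.sum_apply, Matrix.diagonal_apply, energy]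

/-- Conjugation by a diagonal `Z_j` rescales entries, so the channel is a Schur multiplier. -/
theorem dephase_proj_apply {N : ℕ} (lam : ℝ) (ψ : Ket N) (x y : Bits N) :
    dephase lam (proj ψ) x y
      = ((lam + (1 - lam) / N * ∑ j, sgn x j * sgn y j : ℝ) : ℂ) * (ψ x * star (ψ y)) := by
  simp [dephase, proj, Matrix.vecMulVec_apply, pauliZ_eq, Matrix.sum_apply]
  rw [add_mul, mul_assoc (_ / _), Finset.sum_mul]
  congr 2
  exact Finset.sum_congr rfl fun _ _ => by ring

open scoped ComplexOrder in
theorem dephase_proj_posSemidef {N : ℕ} {lam : ℝ} (h0 : 0 ≤ lam) (h1 : lam ≤ 1) (ψ : Ket N) :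
    (dephase lam (proj ψ)).PosSemidef := by
  have hp : (proj ψ).PosSemidef := Matrix.posSemidef_vecMulVec_self_star ψ
  unfold dephase
  refine (hp.smul (by exact_mod_cast h0)).add (Matrix.PosSemidef.smul ?_ ?_)
  · refine Matrix.posSemidef_sum _ fun j _ => ?_
    have := hp.mul_mul_conjTranspose_same (pauliZ j)
    rwa [(pauliZ_isHermitian j).eq] at this
  · have : 0 ≤ (1 - lam) / N := div_nonneg (by linarith) (Nat.cast_nonneg _)
    exact_mod_cast this

theorem dephase_proj_trace {N : ℕ} (hN : 0 < N) (lam : ℝ) (ψ : Ket N)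
    (hψ : ∑ x, ‖ψ x‖ ^ 2 = 1) : (dephase lam (proj ψ)).trace = 1 := by
  have hN' : (N : ℝ) ≠ 0 := by positivity
  have h : ∀ x, dephase lam (proj ψ) x x = ((‖ψ x‖ ^ 2 : ℝ) : ℂ) := by
    intro x
    rw [dephase_proj_apply]
    simp only [sgn_mul_self, RCLike.star_def, Complex.mul_conj, Complex.normSq_eq_norm_sq]
    have : lam + (1 - lam) / N * ∑ _j : Fin N, (1 : ℝ) = 1 := by
      simp
      field_simp
      ring
    rw [this]
    simp
  rw [Matrix.trace]
  simp only [Matrix.diag_apply, h]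
  exact_mod_cast hψ

theorem sum_norm_sq_commutator {N : ℕ} (lam : ℝ) (ψ : Ket N) :
    ∑ x, ∑ y, ‖(dephase lam (proj ψ) * hamiltonian N - hamiltonian N * dephase lam (proj ψ)) x y‖
        ^ 2
      = ∑ x, ∑ y, ‖ψ x‖ ^ 2 * ‖ψ y‖ ^ 2 * (energy x - energy y) ^ 2
          * (lam + (1 - lam) / N * ∑ j, sgn x j * sgn y j) ^ 2 := by
  refine Finset.sum_congr rfl fun x _ => Finset.sum_congr rfl fun y _ => ?_
  have : (dephase lam (proj ψ) * hamiltonian N - hamiltonian N * dephase lam (proj ψ)) x y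
      = ((energy y - energy x : ℝ) : ℂ) * dephase lam (proj ψ) x y := by
    rw [hamiltonian_eq]
    simp only [Matrix.sub_apply, Matrix.mul_diagonal, Matrix.diagonal_mul]
    push_cast
    ring
  rw [this, dephase_proj_apply]
  simp only [norm_mul, mul_pow, Complex.norm_real, Real.norm_eq_abs, sq_abs, norm_star]
  ring

/-- The expectation value of the function `f` under the weights `p`. -/
def mean {N : ℕ} (p f : Bits N → ℝ) : ℝ := ∑ x, p x * f x

theorem mean_add {N : ℕ} (p f f' : Bits N → ℝ) :
    mean p (fun x => f x + f' x) = mean p f + mean p f' := by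
  simp [mean, mul_add, Finset.sum_add_distrib]

theorem mean_sum {N : ℕ} {ι : Type*} (s : Finset ι) (p : Bits N → ℝ) (f : ι → Bits N → ℝ) :
    mean p (fun x => ∑ i ∈ s, f i x) = ∑ i ∈ s, mean p (f i) := by
  simp only [mean, Finset.mul_sum]
  exact Finset.sum_comm

/-- The squared commutator norm in terms of moments of the basis distribution. -/
theorem sum_commutator_eq_mean {N : ℕ} (p : Bits N → ℝ) (hp : ∑ x, p x = 1) (lam mu : ℝ) :
    ∑ x, ∑ y, p x * p y * (energy x - energy y) ^ 2
          * (lam + mu * ∑ j, sgn x j * sgn y j) ^ 2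
      = 2 * lam ^ 2 * (mean p (fun x => energy x ^ 2) - mean p energy ^ 2)
        + 4 * lam * mu * ∑ j, (mean p (fun x => sgn x j * energy x ^ 2) * mean p (sgn · j)
            - mean p (fun x => sgn x j * energy x) ^ 2)
        + 2 * mu ^ 2 * ∑ j, ∑ k,
            (mean p (fun x => sgn x j * sgn x k * energy x ^ 2)
                * mean p (fun x => sgn x j * sgn x k)
              - mean p (fun x => sgn x j * sgn x k * energy x) ^ 2) := by
  -- With a product weight `u x * u y`, expanding the square factorises the double sum. Expanding
  -- the dephasing factor requires `u = 1`, `Z_j` and `Z_j Z_k`.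
  have key : ∀ u : Bits N → ℝ, ∑ x, ∑ y, p x * p y * (energy x - energy y) ^ 2 * (u x * u y)
      = 2 * (mean p (fun x => u x * energy x ^ 2) * mean p u
          - mean p (fun x => u x * energy x) ^ 2) := by
    intro u
    have e : ∀ x y, p x * p y * (energy x - energy y) ^ 2 * (u x * u y)
        = (p x * (u x * energy x ^ 2)) * (p y * u y) + (p x * u x) * (p y * (u y * energy y ^ 2))
          - 2 * ((p x * (u x * energy x)) * (p y * (u y * energy y))) := fun x y => by ring
    simp only [e, Finset.sum_add_distrib, Finset.sum_sub_distrib, ← Finset.mul_sum,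
      ← Finset.sum_mul, mean]
    ring
  have e : ∀ x y, p x * p y * (energy x - energy y) ^ 2
        * (lam + mu * ∑ j, sgn x j * sgn y j) ^ 2
      = lam ^ 2 * (p x * p y * (energy x - energy y) ^ 2 * (1 * 1))
        + 2 * lam * mu * ∑ j, p x * p y * (energy x - energy y) ^ 2 * (sgn x j * sgn y j)
        + mu ^ 2 * ∑ j, ∑ k, p x * p y * (energy x - energy y) ^ 2
            * ((sgn x j * sgn x k) * (sgn y j * sgn y k)) := by
    intro x y
    have h2 : ∑ j, ∑ k, p x * p y * (energy x - energy y) ^ 2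
            * ((sgn x j * sgn x k) * (sgn y j * sgn y k))
        = p x * p y * (energy x - energy y) ^ 2 * (∑ j, sgn x j * sgn y j) ^ 2 := by
      rw [sq (∑ j, _), Finset.sum_mul_sum, Finset.mul_sum]
      refine Finset.sum_congr rfl fun j _ => ?_
      rw [Finset.mul_sum]
      exact Finset.sum_congr rfl fun k _ => by ring
    rw [h2, ← Finset.mul_sum]
    ring
  have swap1 : ∑ x, ∑ y, ∑ j, p x * p y * (energy x - energy y) ^ 2 * (sgn x j * sgn y j)
      = ∑ j, ∑ x, ∑ y, p x * p y * (energy x - energy y) ^ 2 * (sgn x j * sgn y j) := by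
    exact (Finset.sum_congr rfl fun x _ => Finset.sum_comm).trans Finset.sum_comm
  have swap2 : ∑ x, ∑ y, ∑ j, ∑ k, p x * p y * (energy x - energy y) ^ 2
            * ((sgn x j * sgn x k) * (sgn y j * sgn y k))
      = ∑ j, ∑ k, ∑ x, ∑ y, p x * p y * (energy x - energy y) ^ 2
            * ((sgn x j * sgn x k) * (sgn y j * sgn y k)) := by
    refine ((Finset.sum_congr rfl fun x _ => Finset.sum_comm).trans Finset.sum_comm).trans ?_
    refine Finset.sum_congr rfl fun j _ => ?_
    exact (Finset.sum_congr rfl fun x _ => Finset.sum_comm).trans Finset.sum_comm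
  have hone : mean p (fun _ => 1) = 1 := by simpa [mean] using hp
  have pull : ∀ (c : ℝ) (F : Bits N → Bits N → ℝ), ∑ x, ∑ y, c * F x y = c * ∑ x, ∑ y, F x y :=
    fun c F => by simp only [Finset.mul_sum]
  simp only [e, Finset.sum_add_distrib]
  rw [pull, pull, pull, swap1, swap2]
  simp only [key (fun _ => 1), key (fun x => sgn x _), key (fun x => sgn x _ * sgn x _), hone]
  simp only [← Finset.mul_sum, one_mul, mul_one]
  ring

end Gnu

/-! ### Binomial moments. -/

theorem Finset.sum_range_choose_succ_mul (n : ℕ) (f : ℕ → ℝ) :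
    ∑ j ∈ Finset.range (n + 2), ((n + 1).choose j : ℝ) * f j
      = ∑ j ∈ Finset.range (n + 1), (n.choose j : ℝ) * f j
        + ∑ j ∈ Finset.range (n + 1), (n.choose j : ℝ) * f (j + 1) :=
  Finset.sum_choose_succ_mul (fun i _ => f i) n

/-- The first five moments of a shifted sum of `n` independent fair signs. -/
theorem sum_choose_mul_shift_pow (n : ℕ) (t : ℝ) :
    ∑ j ∈ Finset.range (n + 1), (n.choose j : ℝ) * (t - 2 * j) ^ 0
        = 2 ^ n * 1 ∧
    ∑ j ∈ Finset.range (n + 1), (n.choose j : ℝ) * (t - 2 * j) ^ 1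
        = 2 ^ n * (t - n) ∧
    ∑ j ∈ Finset.range (n + 1), (n.choose j : ℝ) * (t - 2 * j) ^ 2
        = 2 ^ n * ((t - n) ^ 2 + n) ∧
    ∑ j ∈ Finset.range (n + 1), (n.choose j : ℝ) * (t - 2 * j) ^ 3
        = 2 ^ n * ((t - n) ^ 3 + 3 * n * (t - n)) ∧
    ∑ j ∈ Finset.range (n + 1), (n.choose j : ℝ) * (t - 2 * j) ^ 4
        = 2 ^ n * ((t - n) ^ 4 + 6 * n * (t - n) ^ 2 + 3 * n ^ 2 - 2 * n) := by
  -- Pascal's rule reduces `n + 1` to `n` at the shifts `t` and `t - 2`, hence the free `t`.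
  induction n generalizing t with
  | zero => simp
  | succ n ih =>
    have hs : ∀ k : ℕ, ∑ j ∈ Finset.range (n + 2), ((n + 1).choose j : ℝ) * (t - 2 * j) ^ k
        = ∑ j ∈ Finset.range (n + 1), (n.choose j : ℝ) * (t - 2 * j) ^ k
          + ∑ j ∈ Finset.range (n + 1), (n.choose j : ℝ) * (t - 2 - 2 * j) ^ k := by
      intro k
      rw [Finset.sum_range_choose_succ_mul n fun j => (t - 2 * j) ^ k]
      congr 1
      refine Finset.sum_congr rfl fun j _ => ?_
      push_cast
      ring
    obtain ⟨a0, a1, a2, a3, a4⟩ := ih t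
    obtain ⟨b0, b1, b2, b3, b4⟩ := ih (t - 2)
    refine ⟨?_, ?_, ?_, ?_, ?_⟩
    · rw [hs, a0, b0]; ring
    · rw [hs, a1, b1]; push_cast; ring
    · rw [hs, a2, b2]; push_cast; ring
    · rw [hs, a3, b3]; push_cast; ring
    · rw [hs, a4, b4]; push_cast; ring

/-! ### Permutation-invariant moments and their recursion. -/

namespace Gnu

theorem weight_cons {N : ℕ} (b : Fin 2) (x : Bits N) :
    weight (Fin.cons b x : Bits (N + 1)) = b + weight x := by
  simp [weight, Fin.sum_univ_succ]

theorem sum_weight (N : ℕ) (f : ℕ → ℝ) :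
    ∑ x : Bits N, f (weight x) = ∑ w ∈ Finset.range (N + 1), (N.choose w : ℝ) * f w := by
  induction N generalizing f with
  | zero => simp [weight]
  | succ N ih =>
    rw [Finset.sum_range_choose_succ_mul, ← ih, ← ih fun w => f (w + 1),
      ← (Fin.consEquiv fun _ => Fin 2).sum_comp, Fintype.sum_prod_type, Fin.sum_univ_two]
    simp [Fin.consEquiv, weight_cons, add_comm 1]

theorem weight_comp_perm {N : ℕ} (σ : Equiv.Perm (Fin N)) (x : Bits N) :
    weight (x ∘ σ) = weight x :=
  Equiv.sum_comp σ fun i => (x i : ℕ)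

theorem energy_comp_perm {N : ℕ} (σ : Equiv.Perm (Fin N)) (x : Bits N) :
    energy (x ∘ σ) = energy x :=
  Equiv.sum_comp σ fun i => sgn x i

/-- The moment `⟨Z_S H^m⟩` of the weights `p`, where `Z_S` is the product of the `Z_i`, `i ∈ S`. -/
def moment {N : ℕ} (p : Bits N → ℝ) (S : Finset (Fin N)) (m : ℕ) : ℝ :=
  mean p fun x => (∏ i ∈ S, sgn x i) * energy x ^ m

/-- A bijection `S ≃ T` extends to a permutation of the qubits, which preserves both `p` and the
energy. -/
theorem moment_eq_of_card_eq {N : ℕ} {p : Bits N → ℝ}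
    (hp : ∀ (σ : Equiv.Perm (Fin N)) x, p (x ∘ σ) = p x) {S T : Finset (Fin N)}
    (h : S.card = T.card) (m : ℕ) : moment p S m = moment p T m := by
  let σ : Equiv.Perm (Fin N) := (Finset.equivOfCardEq h).extendSubtype
  have hST : S.map σ.toEmbedding = T := by
    refine Finset.eq_of_subset_of_card_le ?_ (by rw [Finset.card_map, h])
    intro i hi
    obtain ⟨j, hj, rfl⟩ := Finset.mem_map.mp hi
    exact (Finset.equivOfCardEq h).extendSubtype_mem j hj
  symm
  unfold moment mean
  rw [← Equiv.sum_comp (σ.arrowCongr (Equiv.refl (Fin 2)))]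
  refine Finset.sum_congr rfl fun x _ => ?_
  have e : σ.arrowCongr (Equiv.refl (Fin 2)) x = x ∘ σ.symm := rfl
  rw [e, hp]
  beta_reduce
  rw [energy_comp_perm, ← hST, Finset.prod_map]
  simp [sgn]

/-- Multiplying `Z_S` by `H` either removes or adds one factor. -/
theorem moment_succ {N : ℕ} (p : Bits N → ℝ) (S : Finset (Fin N)) (m : ℕ) :
    moment p S (m + 1)
      = ∑ i ∈ S, moment p (S.erase i) m + ∑ i ∈ Sᶜ, moment p (insert i S) m := by
  unfold moment
  rw [← mean_sum, ← mean_sum, ← mean_add]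
  congr 1
  funext x
  have h1 : ∀ i ∈ S, (∏ j ∈ S.erase i, sgn x j) * energy x ^ m
      = (∏ j ∈ S, sgn x j) * energy x ^ m * sgn x i := by
    intro i hi
    rw [← Finset.mul_prod_erase S _ hi]
    linear_combination -(∏ j ∈ S.erase i, sgn x j) * energy x ^ m * sgn_mul_self x i
  have h2 : ∀ i ∈ Sᶜ, (∏ j ∈ insert i S, sgn x j) * energy x ^ m
      = (∏ j ∈ S, sgn x j) * energy x ^ m * sgn x i := by
    intro i hi
    rw [Finset.prod_insert (Finset.mem_compl.mp hi)]
    ring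
  rw [Finset.sum_congr rfl h1, Finset.sum_congr rfl h2, Finset.sum_add_sum_compl,
    ← Finset.mul_sum, pow_succ, mul_assoc]
  rfl

/-- The first `k` qubits. -/
def firstQubits (N k : ℕ) : Finset (Fin N) := ((List.finRange N).take k).toFinset

theorem card_firstQubits {N k : ℕ} (h : k ≤ N) : (firstQubits N k).card = k := by
  rw [firstQubits, List.toFinset_card_of_nodup ((List.nodup_finRange N).take), List.length_take,
    List.length_finRange, min_eq_left h]

theorem moment_firstQubits {N : ℕ} {p : Bits N → ℝ}
    (hp : ∀ (σ : Equiv.Perm (Fin N)) x, p (x ∘ σ) = p x) (S : Finset (Fin N)) (m : ℕ) :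
    moment p S m = moment p (firstQubits N S.card) m :=
  moment_eq_of_card_eq hp (card_firstQubits (by simpa using S.card_le_univ)).symm m

/-- The boundary values are harmless: the truncated `k - 1` at `k = 0` and the overflowing `k + 1`
at `k = N` both carry coefficient `0`. -/
theorem moment_firstQubits_succ {N : ℕ} {p : Bits N → ℝ}
    (hp : ∀ (σ : Equiv.Perm (Fin N)) x, p (x ∘ σ) = p x) {k : ℕ} (hk : k ≤ N) (m : ℕ) :
    moment p (firstQubits N k) (m + 1)
      = k * moment p (firstQubits N (k - 1)) m
        + ((N : ℝ) - k) * moment p (firstQubits N (k + 1)) m := by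
  have hc := card_firstQubits hk
  have h1 : ∀ i ∈ firstQubits N k, moment p ((firstQubits N k).erase i) m
      = moment p (firstQubits N (k - 1)) m := by
    intro i hi
    rw [moment_firstQubits hp, Finset.card_erase_of_mem hi, hc]
  have h2 : ∀ i ∈ (firstQubits N k)ᶜ, moment p (insert i (firstQubits N k)) m
      = moment p (firstQubits N (k + 1)) m := by
    intro i hi
    rw [moment_firstQubits hp, Finset.card_insert_of_notMem (Finset.mem_compl.mp hi), hc]
  rw [moment_succ, Finset.sum_congr rfl h1, Finset.sum_congr rfl h2]
  simp [Finset.card_compl, hc, Nat.cast_sub hk]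

theorem zString_eq (N k : ℕ) :
    zString N k
      = Matrix.diagonal fun x : Bits N => ((∏ i ∈ firstQubits N k, sgn x i : ℝ) : ℂ) := by
  have h : ∀ l : List (Fin N), (l.map pauliZ).prod
      = Matrix.diagonal fun x : Bits N => (((l.map (sgn x)).prod : ℝ) : ℂ) := by
    intro l
    induction l with
    | nil => simp
    | cons a l ih => simp [ih, pauliZ_eq]
  rw [zString, h]
  simp only [firstQubits, List.prod_toFinset _ (List.nodup_finRange N).take]

theorem corr_eq_moment (N g n k : ℕ) :
    corr N g n k = moment (fun x => ‖probe N g n x‖ ^ 2) (firstQubits N k) 0 := by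
  have h : expect (probe N g n) (zString N k)
      = ((moment (fun x => ‖probe N g n x‖ ^ 2) (firstQubits N k) 0 : ℝ) : ℂ) := by
    rw [zString_eq]
    simp only [expect, dotProduct, Matrix.mulVec_diagonal, moment, mean, Pi.star_apply, pow_zero,
      mul_one, Complex.ofReal_sum]
    refine Finset.sum_congr rfl fun x _ => ?_
    rw [mul_left_comm, RCLike.star_def, Complex.conj_mul', mul_comm]
    push_cast
    rfl
  rw [corr, h, Complex.ofReal_re]

end Gnu

/-! ### The distribution of the probe state. -/

namespace Gnu

theorem norm_sq_probe {N g n : ℕ} (hg : 0 < g) (x : Bits N) :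
    ‖probe N g n x‖ ^ 2
      = ∑ j ∈ Finset.range (n + 1),
          if weight x = g * j then (2 : ℝ)⁻¹ ^ n * n.choose j / N.choose (g * j) else 0 := by
  have hp : probe N g n x = ∑ j ∈ Finset.range (n + 1), if weight x = g * j then
      ((√((2 : ℝ)⁻¹ ^ n) * √(n.choose j : ℝ) * (1 / √(N.choose (g * j) : ℝ)) : ℝ) : ℂ) else 0 := by
    simp only [probe, Finset.sum_apply, Pi.smul_apply, dicke, smul_eq_mul, mul_ite, mul_zero,
      Complex.ofReal_mul]
  by_cases h : ∃ j ∈ Finset.range (n + 1), weight x = g * j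
  · obtain ⟨j, hj, hx⟩ := h
    -- The levels `g * i` are distinct because `0 < g`, so squaring the amplitude produces no cross
    -- terms.
    have hne : ∀ i, i ≠ j → ¬ weight x = g * i := by
      intro i hi he
      exact hi (Nat.eq_of_mul_eq_mul_left hg (he.symm.trans hx))
    rw [hp, Finset.sum_eq_single_of_mem j hj fun i _ hi => if_neg (hne i hi),
      Finset.sum_eq_single_of_mem j hj fun i _ hi => if_neg (hne i hi), if_pos hx, if_pos hx,
      Complex.norm_real, Real.norm_eq_abs, sq_abs, mul_pow, mul_pow, div_pow,
      Real.sq_sqrt (by positivity), Real.sq_sqrt (by positivity), Real.sq_sqrt (by positivity)]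
    ring
  · push Not at h
    rw [hp, Finset.sum_eq_zero fun i hi => if_neg (h i hi),
      Finset.sum_eq_zero fun i hi => if_neg (h i hi)]
    simp

theorem norm_sq_probe_comp_perm {N g n : ℕ} (hg : 0 < g) (σ : Equiv.Perm (Fin N)) (x : Bits N) :
    ‖probe N g n (x ∘ σ)‖ ^ 2 = ‖probe N g n x‖ ^ 2 := by
  rw [norm_sq_probe hg, norm_sq_probe hg, weight_comp_perm]

/-- In the probe state the weight is `g` times a fair binomial variable. -/
theorem sum_norm_sq_probe_mul {N g n : ℕ} (hg : 0 < g) (hN : g * n ≤ N) (F : ℕ → ℝ) :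
    ∑ x, ‖probe N g n x‖ ^ 2 * F (weight x)
      = (2 : ℝ)⁻¹ ^ n * ∑ j ∈ Finset.range (n + 1), (n.choose j : ℝ) * F (g * j) := by
  simp only [norm_sq_probe hg]
  rw [sum_weight N fun w => (∑ j ∈ Finset.range (n + 1),
      if w = g * j then (2 : ℝ)⁻¹ ^ n * n.choose j / N.choose (g * j) else 0) * F w]
  simp only [Finset.sum_mul, Finset.mul_sum]
  rw [Finset.sum_comm]
  refine Finset.sum_congr rfl fun j hj => ?_
  have hj' : g * j ≤ N :=
    (Nat.mul_le_mul_left g (Nat.lt_succ_iff.mp (Finset.mem_range.mp hj))).trans hN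
  have hc : (N.choose (g * j) : ℝ) ≠ 0 := by exact_mod_cast (Nat.choose_pos hj').ne'
  -- The number of strings of weight `g * j` cancels the Dicke normalisation.
  rw [Finset.sum_eq_single_of_mem (g * j) (Finset.mem_range.mpr (Nat.lt_succ_iff.mpr hj'))]
  · rw [if_pos rfl]
    field_simp
  · intro w _ hw
    simp [hw]

theorem moment_empty_probe {g n : ℕ} (hg : 0 < g) (m : ℕ) :
    moment (fun x => ‖probe (2 * g * n) g n x‖ ^ 2) ∅ m
      = g ^ m * ((2 : ℝ)⁻¹ ^ n
          * ∑ j ∈ Finset.range (n + 1), (n.choose j : ℝ) * (2 * n - 2 * j : ℝ) ^ m) := by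
  simp only [moment, mean, Finset.prod_empty, one_mul, energy_eq]
  rw [sum_norm_sq_probe_mul hg (by nlinarith [Nat.zero_le (g * n)])
    fun w => ((2 * g * n : ℕ) - 2 * w : ℝ) ^ m, mul_left_comm, Finset.mul_sum _ _ ((g : ℝ) ^ m)]
  congr 1
  refine Finset.sum_congr rfl fun j _ => ?_
  rw [mul_left_comm, ← mul_pow]
  push_cast
  ring

/-! ### The commutator norm for permutation-invariant weights. -/

section PermInvariant

variable {N : ℕ} {p : Bits N → ℝ}

theorem mean_sgn_mul (hp : ∀ (σ : Equiv.Perm (Fin N)) x, p (x ∘ σ) = p x) (j : Fin N) (m : ℕ) :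
    mean p (fun x => sgn x j * energy x ^ m) = moment p (firstQubits N 1) m := by
  have := moment_firstQubits hp {j} m
  simpa [moment] using this

theorem mean_sgn_mul_sgn_mul (hp : ∀ (σ : Equiv.Perm (Fin N)) x, p (x ∘ σ) = p x) (j k : Fin N)
    (m : ℕ) :
    mean p (fun x => sgn x j * sgn x k * energy x ^ m)
      = if j = k then moment p (firstQubits N 0) m else moment p (firstQubits N 2) m := by
  split_ifs with h
  · subst h
    simp [sgn_mul_self, moment, firstQubits]
  · have := moment_firstQubits hp {j, k} m
    rw [Finset.card_pair h] at this
    simpa [moment, Finset.prod_pair h] using this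

/-- The squared commutator norm for permutation invariant weights. -/
theorem sum_commutator_eq_moment (hp : ∀ (σ : Equiv.Perm (Fin N)) x, p (x ∘ σ) = p x)
    (h1 : ∑ x, p x = 1) (lam mu : ℝ) :
    ∑ x, ∑ y, p x * p y * (energy x - energy y) ^ 2
          * (lam + mu * ∑ j, sgn x j * sgn y j) ^ 2
      = 2 * lam ^ 2 * (moment p (firstQubits N 0) 2 - moment p (firstQubits N 0) 1 ^ 2)
        + 4 * lam * mu * (N * (moment p (firstQubits N 1) 2 * moment p (firstQubits N 1) 0
            - moment p (firstQubits N 1) 1 ^ 2))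
        + 2 * mu ^ 2 * (N * (moment p (firstQubits N 0) 2 * moment p (firstQubits N 0) 0
              - moment p (firstQubits N 0) 1 ^ 2)
            + N * (N - 1) * (moment p (firstQubits N 2) 2 * moment p (firstQubits N 2) 0
              - moment p (firstQubits N 2) 1 ^ 2)) := by
  have s0 := fun j => mean_sgn_mul hp j 0
  have s1 := fun j => mean_sgn_mul hp j 1
  have d0 := fun j k => mean_sgn_mul_sgn_mul hp j k 0
  have d1 := fun j k => mean_sgn_mul_sgn_mul hp j k 1
  simp only [pow_zero, mul_one, pow_one] at s0 s1 d0 d1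
  have e1 : mean p energy = moment p (firstQubits N 0) 1 := by simp [moment, firstQubits]
  have e2 : mean p (fun x => energy x ^ 2) = moment p (firstQubits N 0) 2 := by
    simp [moment, firstQubits]
  have hsum : ∀ A B : ℝ, ∑ j : Fin N, ∑ k : Fin N, (if j = k then A else B)
      = N * A + N * (N - 1) * B := by
    intro A B
    have : ∀ j k : Fin N, (if j = k then A else B) = B + if j = k then A - B else 0 := by
      intro j k; split_ifs <;> ring
    simp only [this, Finset.sum_add_distrib]
    simp
    ring
  rw [sum_commutator_eq_mean p h1]
  simp only [s0, s1, mean_sgn_mul hp, d0, d1, mean_sgn_mul_sgn_mul hp, e1, e2]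
  rw [← hsum]
  simp only [Finset.sum_const, Finset.card_univ, Fintype.card_fin, nsmul_eq_mul]
  congr 2
  refine Finset.sum_congr rfl fun j _ => Finset.sum_congr rfl fun k _ => ?_
  split_ifs <;> rfl

end PermInvariant

end Gnu

/-! ### Solving the recursion and assembling the bound. -/

theorem theorem3 (g n N : ℕ) (hg : 0 < g) (hn : 0 < n) (hN : N = 2 * g * n)
    (lam : ℝ) (hlam0 : 0 ≤ lam) (hlam1 : lam ≤ 1) :
    (2 * (g : ℝ) ^ 2 * n * lam ^ 2
        + 2 * lam * (1 - lam) * ((g : ℝ) ^ 2 * ((n : ℝ) - 1) / 2)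
        + (1 - lam) ^ 2 *
          (Gnu.g2 N (Gnu.corr N g n 2) (Gnu.corr N g n 3) (Gnu.corr N g n 4) / (N : ℝ) ^ 2)
      ≤ Gnu.qfi (Gnu.dephase lam (Gnu.proj (Gnu.probe N g n))) (Gnu.hamiltonian N)
          (Gnu.noisy_isHermitian N g n lam))
    ∧ Gnu.corr N g n 2 = ((g : ℝ) * (n + 1) - 2) / (4 * g * n - 2)
    ∧ (2 ≤ g * n →
        Gnu.corr N g n 3
            = ((g : ℝ) ^ 2 * n * (n + 3) - 6 * g * n + 2)
              / (4 * ((g : ℝ) * n - 1) * (2 * g * n - 1))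
        ∧ Gnu.corr N g n 4
            = (((n : ℝ) ^ 3 + 6 * n ^ 2 + 3 * n - 2) * g ^ 3 - 12 * n * (n + 1) * g ^ 2
                + 4 * (5 * n + 2) * g - 12)
              / (4 * ((g : ℝ) * n - 1) * (2 * g * n - 3) * (2 * g * n - 1))) := by
  set p : Gnu.Bits N → ℝ := fun x => ‖Gnu.probe N g n x‖ ^ 2 with hpdef
  have hperm : ∀ (σ : Equiv.Perm (Fin N)) x, p (x ∘ σ) = p x :=
    Gnu.norm_sq_probe_comp_perm hg
  set a : ℕ → ℕ → ℝ := fun k m => Gnu.moment p (Gnu.firstQubits N k) m with ha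
  have hgn : 1 ≤ g * n := Nat.mul_pos hg hn
  have hN2 : 2 ≤ N := by rw [hN, mul_assoc]; omega
  have hNr : (N : ℝ) = 2 * (g * n) := by rw [hN]; push_cast; ring
  have hgn' : (1 : ℝ) ≤ g * n := by exact_mod_cast hgn
  have hN0 : (N : ℝ) ≠ 0 := by rw [hNr]; positivity
  have hrec : ∀ k m, k ≤ N → a k (m + 1) = k * a (k - 1) m + ((N : ℝ) - k) * a (k + 1) m :=
    fun k m hk => Gnu.moment_firstQubits_succ hperm hk m
  have h0 : ∀ m, a 0 m = g ^ m * ((2 : ℝ)⁻¹ ^ n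
      * ∑ j ∈ Finset.range (n + 1), (n.choose j : ℝ) * (2 * n - 2 * j : ℝ) ^ m) := by
    subst hN
    intro m
    rw [← Gnu.moment_empty_probe hg]
    simp [a, Gnu.firstQubits, hpdef]
  obtain ⟨b0, b1, b2, b3, b4⟩ := sum_choose_mul_shift_pow n (2 * n)
  have hpow : ∀ c : ℝ, (2 : ℝ)⁻¹ ^ n * (2 ^ n * c) = c := by
    intro c
    rw [← mul_assoc, ← mul_pow]
    norm_num
  have E0 : a 0 0 = 1 := by rw [h0, b0, hpow]; ring
  have E1 : a 0 1 = g * n := by rw [h0, b1, hpow]; ring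
  have E2 : a 0 2 = g ^ 2 * (n ^ 2 + n) := by rw [h0, b2, hpow]; ring
  have E3 : a 0 3 = g ^ 3 * (n ^ 3 + 3 * n ^ 2) := by rw [h0, b3, hpow]; ring
  have E4 : a 0 4 = g ^ 4 * (n ^ 4 + 6 * n ^ 3 + 3 * n ^ 2 - 2 * n) := by
    rw [h0, b4, hpow]; ring
  have r0 : ∀ m, a 0 (m + 1) = N * a 1 m := fun m => by
    simpa using hrec 0 m (Nat.zero_le _)
  have r1 : ∀ m, a 1 (m + 1) = a 0 m + (N - 1) * a 2 m := fun m => by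
    simpa using hrec 1 m (by omega)
  have r2 : ∀ m, a 2 (m + 1) = 2 * a 1 m + (N - 2) * a 3 m := fun m => by
    simpa using hrec 2 m hN2
  -- For `N = 2` the recursion at `k = 3` is unavailable; the factor `N - 2`, with which `a 3 1`
  -- occurs in `q22`, covers this case.
  have r3 : ((N : ℝ) - 2) * a 3 1 = (N - 2) * (3 * a 2 0 + (N - 3) * a 4 0) := by
    rcases hN2.eq_or_lt with h | h
    · rw [← h]; simp
    · rw [show a 3 1 = 3 * a 2 0 + (N - 3) * a 4 0 by simpa using hrec 3 0 h]
  have c : ∀ k, Gnu.corr N g n k = a k 0 := Gnu.corr_eq_moment N g n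
  have A10 : a 1 0 = 1 / 2 := by
    have := r0 0
    rw [zero_add, E1, hNr] at this
    have h : (g * n : ℝ) * (a 1 0 - 1 / 2) = 0 := by linarith
    rcases mul_eq_zero.mp h with h | h <;> linarith
  have A11 : a 1 1 = g * (n + 1) / 2 := by
    have := r0 1
    norm_num [E2, hNr] at this
    have h : (g * n : ℝ) * (a 1 1 - g * (n + 1) / 2) = 0 := by linarith
    rcases mul_eq_zero.mp h with h | h <;> linarith
  have A12 : a 1 2 = g ^ 2 * n * (n + 3) / 2 := by
    have := r0 2
    norm_num [E3, hNr] at this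
    have h : (g * n : ℝ) * (a 1 2 - g ^ 2 * n * (n + 3) / 2) = 0 := by linarith
    rcases mul_eq_zero.mp h with h | h <;> linarith
  have A13 : a 1 3 = g ^ 3 * (n ^ 3 + 6 * n ^ 2 + 3 * n - 2) / 2 := by
    have := r0 3
    norm_num [E4, hNr] at this
    have h : (g * n : ℝ) * (a 1 3 - g ^ 3 * (n ^ 3 + 6 * n ^ 2 + 3 * n - 2) / 2) = 0 := by
      linarith
    rcases mul_eq_zero.mp h with h | h <;> linarith
  have q11 : a 1 1 = 1 + (N - 1) * a 2 0 := by rw [r1 0, E0]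
  have q12 : a 1 2 = a 0 1 + (N - 1) * a 2 1 := r1 1
  have q13 : a 1 3 = a 0 2 + (N - 1) * a 2 2 := r1 2
  have q21 : a 2 1 = 2 * a 1 0 + (N - 2) * a 3 0 := r2 0
  have q22 : a 2 2 = 2 * a 1 1 + (N - 2) * a 3 1 := r2 1
  have q02 : a 0 2 = N * (1 + (N - 1) * a 2 0) := by rw [r0 1, q11]
  refine ⟨?_, ?_, ?_⟩
  · have hnorm : ∑ x, p x = 1 := by
      rw [← E0]
      simp [ha, Gnu.moment, Gnu.mean, Gnu.firstQubits]
    refine le_of_eq_of_le ?_ (Gnu.sum_norm_sq_commutator_le_qfi (Gnu.hamiltonian N)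
      (Gnu.dephase_proj_posSemidef hlam0 hlam1 (Gnu.probe N g n))
      (Gnu.dephase_proj_trace (by omega) lam _ hnorm))
    rw [Gnu.sum_norm_sq_commutator]
    rw [Gnu.sum_commutator_eq_moment hperm hnorm]
    change _ = 2 * lam ^ 2 * (a 0 2 - a 0 1 ^ 2)
        + 4 * lam * ((1 - lam) / N) * (N * (a 1 2 * a 1 0 - a 1 1 ^ 2))
        + 2 * ((1 - lam) / N) ^ 2 * (N * (a 0 2 * a 0 0 - a 0 1 ^ 2)
            + N * (N - 1) * (a 2 2 * a 2 0 - a 2 1 ^ 2))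
    have t1 : 2 * lam ^ 2 * (a 0 2 - a 0 1 ^ 2) = 2 * (g : ℝ) ^ 2 * n * lam ^ 2 := by
      rw [E2, E1]; ring
    have t2 : 4 * lam * ((1 - lam) / N) * (N * (a 1 2 * a 1 0 - a 1 1 ^ 2))
        = 2 * lam * (1 - lam) * ((g : ℝ) ^ 2 * ((n : ℝ) - 1) / 2) := by
      rw [A12, A11, A10]; field_simp; ring
    -- Here `v_2`, `v_3`, `v_4` stay symbolic: only the recursion, `a 0 0 = 1`, `a 1 0 = 1 / 2` and
    -- `a 0 1 = N / 2` are needed. The last one gives the `N ^ 3 / 4` in `z112`.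
    have t3 : 2 * (N * (a 0 2 * a 0 0 - a 0 1 ^ 2)
          + N * (N - 1) * (a 2 2 * a 2 0 - a 2 1 ^ 2))
        = Gnu.g2 N (a 2 0) (a 3 0) (a 4 0) := by
      have E1' : a 0 1 = N / 2 := by rw [E1, hNr]; ring
      rw [q02, E0, E1', q22, q21, r3, q11, A10, Gnu.g2, Gnu.z022, Gnu.z112]
      ring
    rw [t1, t2, c, c, c, ← t3]
    ring
  · have h1 : (4 * g * n - 2 : ℝ) ≠ 0 := by nlinarith
    rw [c, eq_div_iff h1]
    rw [A11, hNr] at q11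
    linear_combination -2 * q11
  · intro h2
    have h2' : (2 : ℝ) ≤ g * n := by exact_mod_cast h2
    have n1 : (g * n - 1 : ℝ) ≠ 0 := by linarith
    have n2 : (2 * g * n - 1 : ℝ) ≠ 0 := by linarith
    have n3 : (2 * g * n - 3 : ℝ) ≠ 0 := by linarith
    rw [hNr] at q11 q12 q13 q21 q22 r3
    rw [A12, E1] at q12
    rw [A13, E2] at q13
    rw [A10] at q21
    rw [A11] at q11 q22
    rw [c, c, eq_div_iff (by positivity), eq_div_iff (by positivity)]
    constructor
    -- This eliminates `a 2 1`; the next combination eliminates `a 2 2`, `a 3 1` and `a 2 0`.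
    · linear_combination -2 * q12 - 2 * (2 * (g * n) - 1) * q21
    · linear_combination -2 * q13 - 2 * (2 * (g * n) - 1) * q22 - 2 * (2 * (g * n) - 1) * r3
        + 6 * (2 * (g * n) - 2) * q11
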